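/- Let $(N,g)$ be a smooth finite-dimensional Riemannian manifold (without boundary), let $V\colon N\to\mathbb{R}$ be a smooth function, and let $\phi\colon\mathbb{R}^n\to N$ be a smooth harmonic map with potential $V$, that is, a smooth map satisfying $\tau(\phi)=-\nabla V(\phi)$, where $\tau(\phi)=\operatorname{tr}\nabla d\phi$ is the tension field of $\phi$ (with respect to the Euclidean metric on $\mathbb{R}^n$ and the metric $g$ on $N$) and $\nabla V$ is the gradient of $V$ on $(N,g)$. For $x\in\mathbb{R}^n$ and $r>0$ let $B_r(x)$ be the open Euclidean ball of radius $r$ around $x$, let $d\sigma$ be the surface measure on $\partial B_r(x)$, and let $\frac{\partial\phi}{\partial r}(y)=d\phi_y\big(\frac{y-x}{|y-x|}\big)$ be the radial derivative of $\phi$. Then, for every $x\in\mathbb{R}^n$ and every $r>0$, all the integrals below converge absolutely, the function $\rho\mapsto\rho^{2-n}\int_{B_\rho(x)}\big(\tfrac12|d\phi|^2-V(\phi)\big)\,dy$ is differentiable at $\rho=r$, and $$\frac{d}{dr}\left(r^{2-n}\int_{B_r(x)}\Big(\tfrac12|d\phi|^2-V(\phi)\Big)\,dy\right)=r^{2-n}\int_{\partial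 B_r(x)}\Big|\frac{\partial\phi}{\partial r}\Big|^2\,d\sigma-2r^{1-n}\int_{B_r(x)}V(\phi)\,dy .$$ -/

import Mathlib

open scoped Manifold ContDiff Bundle

noncomputable section

namespace HarmonicPotential

/-- The model space `ℝⁿ` with its Euclidean structure. -/
abbrev E (n : ℕ) : Type := EuclideanSpace ℝ (Fin n)

/-- The `i`-th standard basis vector of `ℝⁿ`. -/
def stdVec {n : ℕ} (i : Fin n) : E n := EuclideanSpace.single i (1 : ℝ)

section Target

variable {m : ℕ} {N : Type*} [TopologicalSpace N] [ChartedSpace (E m) N]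

/-- The coordinate vector field `∂/∂yᵃ` of the chart of `N` around `p`, at the point of `N` with
coordinates `y`. -/
def coordVec (p : N) (y : E m) (a : Fin m) :
    TangentSpace (𝓡 m) ((extChartAt (𝓡 m) p).symm y) :=
  mfderiv (𝓡 m) (𝓡 m) (extChartAt (𝓡 m) p).symm y (stdVec a)

variable [IsManifold (𝓡 m) ∞ N]
  [Bundle.RiemannianBundle (fun q : N ↦ TangentSpace (𝓡 m) q)]

/-- The matrix `g_{ab}(y) = ⟨∂/∂yᵃ, ∂/∂yᵇ⟩` of the Riemannian metric of `N` in the chart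
around `p`. -/
def metricMatrix (p : N) (y : E m) : Matrix (Fin m) (Fin m) ℝ :=
  Matrix.of fun a b ↦ inner ℝ (coordVec p y a) (coordVec p y b)

/-- The partial derivative `∂g_{ab}/∂yᶜ` at the point with coordinates `y`. -/
def dMetric (p : N) (y : E m) (c a b : Fin m) : ℝ :=
  fderiv ℝ (fun z : E m ↦ metricMatrix p z a b) y (stdVec c)

/-- The Christoffel symbols
`Γᶜ_{ab} = ½ ∑_d g^{cd} (∂_a g_{bd} + ∂_b g_{ad} - ∂_d g_{ab})`
of the Levi-Civita connection of `N` in the chart around `p`, at the point with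
coordinates `y`. -/
def christoffel (p : N) (y : E m) (c a b : Fin m) : ℝ :=
  (1 / 2 : ℝ) * ∑ d, (metricMatrix p y)⁻¹ c d *
    (dMetric p y a b d + dMetric p y b a d - dMetric p y d a b)

/-- The gradient `∇V` of a function `V` on `N`: the tangent vector at `p` that represents the
differential of `V` at `p` through the Riemannian metric. -/
def grad (V : N → ℝ) (p : N) : TangentSpace (𝓡 m) p :=
  haveI : FiniteDimensional ℝ (TangentSpace (𝓡 m) p) :=
    inferInstanceAs (FiniteDimensional ℝ (E m))
  haveI : CompleteSpace (TangentSpace (𝓡 m) p) := FiniteDimensional.complete ℝ _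
  (InnerProductSpace.toDual ℝ (TangentSpace (𝓡 m) p)).symm (mfderiv (𝓡 m) 𝓘(ℝ, ℝ) V p)

/-- The components
`τᶜ = Δ φᶜ + ∑_{i,a,b} Γᶜ_{ab}(φ) ∂_i φᵃ ∂_i φᵇ`
at `x` of the tension field of a map `φ : ℝⁿ → N`, in the chart of `N` around `φ x`. -/
def tensionCoord {n : ℕ} (φ : E n → N) (x : E n) (c : Fin m) : ℝ :=
  let ψ := extChartAt (𝓡 m) (φ x)
  let u : E n → E m := fun y ↦ ψ (φ y)
  (Laplacian.laplacian u x) c +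
    ∑ i, ∑ a, ∑ b, christoffel (m := m) (φ x) (ψ (φ x)) c a b *
      (fderiv ℝ u x (stdVec i)) a * (fderiv ℝ u x (stdVec i)) b

/-- The tension field `τ(φ) = tr ∇dφ` of a map `φ : ℝⁿ → N`, a vector field along `φ`: the
vector `∑_c τᶜ ∂/∂yᶜ`, where the coordinate vectors at `φ x` of the chart around `φ x` are the
images of the standard basis vectors under the inverse of the differential of the chart. -/
def tension {n : ℕ} (φ : E n → N) (x : E n) : TangentSpace (𝓡 m) (φ x) :=
  ∑ c, tensionCoord (m := m) φ x c •
    (mfderiv (𝓡 m) (𝓡 m) (extChartAt (𝓡 m) (φ x)) (φ x)).inverse (stdVec c)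

/-- `φ : ℝⁿ → N` is a smooth harmonic map with potential `V`: it is smooth and
`τ(φ) = -∇V(φ)`. -/
structure IsHarmonicMapWithPotential {n : ℕ} (V : N → ℝ) (φ : E n → N) : Prop where
  smooth : ContMDiff (𝓡 n) (𝓡 m) ∞ φ
  equation : ∀ x, tension (m := m) φ x = -grad V (φ x)

/-- `|dφ|²(x) = ∑_i |dφ(e_i)|²`. -/
def normSqDiff {n : ℕ} (φ : E n → N) (x : E n) : ℝ :=
  ∑ i, ‖mfderiv (𝓡 n) (𝓡 m) φ x (stdVec i)‖ ^ 2

/-- The energy density `½ |dφ|² - V(φ)`. -/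
def energyDensity {n : ℕ} (V : N → ℝ) (φ : E n → N) (x : E n) : ℝ :=
  (1 / 2 : ℝ) * normSqDiff (m := m) φ x - V (φ x)

/-- The radial derivative `∂φ/∂r` at `y`, for the polar coordinates centred at `x`: the image
under `dφ` of the unit vector `(y - x) / |y - x|`. -/
def radialDeriv {n : ℕ} (φ : E n → N) (x y : E n) : TangentSpace (𝓡 m) (φ y) :=
  let v : E n := ‖y - x‖⁻¹ • (y - x)
  mfderiv (𝓡 n) (𝓡 m) φ y v

end Target

/-- The surface measure `σ` of the sphere `∂B_r(x)` (`r > 0`), as a measure on `ℝⁿ`: the image of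
`rⁿ⁻¹` times the surface measure of the unit sphere under `s ↦ x + r s`. -/
def surfaceMeasure {n : ℕ} (x : E n) (r : ℝ) : MeasureTheory.Measure (E n) :=
  ENNReal.ofReal (r ^ (n - 1)) •
    ((MeasureTheory.volume : MeasureTheory.Measure (E n)).toSphere).map
      (fun s : Metric.sphere (0 : E n) 1 ↦ x + r • (s : E n))

end HarmonicPotential

end

/-!
The equation says exactly that the stress-energy tensor `S = e(φ) g₀ - φ*g`, with `e(φ)` the energy
density and `g₀` the Euclidean metric, is divergence free. Hence the divergence of the field
`y ↦ S_y (y - x)` is the trace of `S`, namely `(n - 2) e(φ) - 2 V(φ)`, while its flux through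
`∂B_r(x)` is `r ∫ (e(φ) - |∂φ/∂r|²) dσ`. The divergence theorem on balls turns this into a Pohozaev
identity, in which `∫ e(φ) dσ` is the derivative of `∫_{B_r(x)} e(φ)`.
-/

noncomputable section

namespace HarmonicPotential

open MeasureTheory Set Filter Topology Metric

open scoped RealInnerProductSpace

section PolarCoordinates

variable {X F : Type*} [NormedAddCommGroup X] [NormedSpace ℝ X]
  [NormedAddCommGroup F]

theorem add_smul_mem_sphere (x : X) {s : ℝ} (hs : 0 ≤ s) (θ : sphere (0 : X) 1) :
    x + s • (θ : X) ∈ sphere x s := by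
  simp [norm_smul, abs_of_nonneg hs]

variable [MeasurableSpace X] {μ : Measure X} {f g : X → F} {x : X} {s : ℝ}

theorem integrable_comp_add_smul_sphere [FiniteDimensional ℝ X] [BorelSpace X]
    [μ.IsAddHaarMeasure] (hf : ContinuousOn f (sphere x s)) (hs : 0 ≤ s) :
    Integrable (fun θ : sphere (0 : X) 1 ↦ f (x + s • (θ : X))) μ.toSphere := by
  have hcont : Continuous fun θ : sphere (0 : X) 1 ↦ f (x + s • (θ : X)) :=
    hf.comp_continuous (by fun_prop) (add_smul_mem_sphere x hs)
  exact hcont.integrable_of_hasCompactSupport (HasCompactSupport.of_compactSpace _)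

theorem integrableOn_ball [FiniteDimensional ℝ X] [OpensMeasurableSpace X]
    [IsFiniteMeasureOnCompacts μ] (hf : Continuous f) (x : X) (R : ℝ) :
    IntegrableOn f (ball x R) μ :=
  (hf.continuousOn.integrableOn_compact (isCompact_closedBall x R)).mono_set
    ball_subset_closedBall

variable [NormedSpace ℝ F]

theorem integral_volumeIoiPow (n : ℕ) (f : ℝ → F) :
    ∫ s : Ioi (0 : ℝ), f s ∂.volumeIoiPow n = ∫ s in Ioi (0 : ℝ), s ^ n • f s := by
  simp only [Measure.volumeIoiPow, ENNReal.ofReal]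
  rw [integral_withDensity_eq_integral_smul
      (measurable_subtype_coe.pow_const n).real_toNNReal,
    integral_subtype_comap measurableSet_Ioi fun s ↦ (s ^ n).toNNReal • f s]
  refine setIntegral_congr_fun measurableSet_Ioi fun s hs ↦ ?_
  simp only [NNReal.smul_def, Real.coe_toNNReal _ (pow_nonneg (mem_Ioi.1 hs).le n)]

/-- The integral of `f` over the sphere of radius `s` around `x`, with respect to the surface
measure induced by `μ`. It is defined through polar coordinates, so that it makes sense for all
real `s`. -/
def sphereIntegral (μ : Measure X) (f : X → F) (x : X) (s : ℝ) : F :=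
  s ^ (Module.finrank ℝ X - 1) • ∫ θ : sphere (0 : X) 1, f (x + s • (θ : X)) ∂μ.toSphere

theorem sphereIntegral_congr (hs : 0 ≤ s) (h : EqOn f g (sphere x s)) :
    sphereIntegral μ f x s = sphereIntegral μ g x s := by
  simp only [sphereIntegral, fun θ ↦ h (add_smul_mem_sphere x hs θ)]

theorem sphereIntegral_norm_smul (k : ℝ → ℝ) (f : X → F) (x : X) (hs : 0 ≤ s) :
    sphereIntegral μ (fun y ↦ k ‖y - x‖ • f y) x s = k s • sphereIntegral μ f x s := by
  rw [sphereIntegral_congr (g := fun y ↦ k s • f y) hs fun y hy ↦ by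
    simp only [mem_sphere_iff_norm.1 hy]]
  simp only [sphereIntegral, integral_smul, smul_comm (k s)]

variable [FiniteDimensional ℝ X] [BorelSpace X] [μ.IsAddHaarMeasure]

theorem sphereIntegral_sub (hf : ContinuousOn f (sphere x s)) (hg : ContinuousOn g (sphere x s))
    (hs : 0 ≤ s) : sphereIntegral μ (fun y ↦ f y - g y) x s =
      sphereIntegral μ f x s - sphereIntegral μ g x s := by
  simp only [sphereIntegral, integral_sub (integrable_comp_add_smul_sphere hf hs)
    (integrable_comp_add_smul_sphere hg hs), smul_sub]

theorem continuous_sphereIntegral (hf : Continuous f) (x : X) :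
    Continuous (sphereIntegral μ f x) := by
  have hcont : Continuous (Function.uncurry fun (s : ℝ) (θ : sphere (0 : X) 1) ↦
      f (x + s • (θ : X))) := by fun_prop
  refine (continuous_pow _).smul ?_
  simpa using continuous_parametric_integral_of_continuous (μ := μ.toSphere) hcont isCompact_univ

theorem integral_eq_integral_sphereIntegral [Nontrivial X] (hf : Integrable f μ) (x : X) :
    ∫ y, f y ∂μ = ∫ s in Ioi (0 : ℝ), sphereIntegral μ f x s := by
  set ν := μ.toSphere.prod (.volumeIoiPow (Module.finrank ℝ X - 1))
  set f' : sphere (0 : X) 1 × Ioi (0 : ℝ) → F := fun p ↦ f (x + (p.2 : ℝ) • (p.1 : X)) with hf'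
  have hpolar := μ.measurePreserving_homeomorphUnitSphereProd
  have hemb := (homeomorphUnitSphereProd X).measurableEmbedding
  have hcomp (y : ({0}ᶜ : Set X)) : f' (homeomorphUnitSphereProd X y) = f (x + y) := by
    have hy : ‖(y : X)‖ ≠ 0 := norm_ne_zero_iff.2 y.2
    simp [hf', smul_smul, hy]
  have hint : Integrable f' ν := by
    rw [← hpolar.integrable_comp_emb hemb]
    have hcompl := (hf.comp_add_left x).integrableOn (s := {0}ᶜ)
    rw [integrableOn_iff_comap_subtypeVal (measurableSet_singleton _).compl] at hcompl
    exact hcompl.congr (.of_forall fun y ↦ (hcomp y).symm)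
  calc ∫ y, f y ∂μ = ∫ y, f (x + y) ∂μ := (integral_add_left_eq_self f x).symm
    _ = ∫ y : ({0}ᶜ : Set X), f (x + y) ∂μ.comap (↑) := by
      rw [integral_subtype_comap (measurableSet_singleton _).compl fun y ↦ f (x + y),
        restrict_compl_singleton]
    _ = ∫ p, f' p ∂ν := by rw [← hpolar.integral_comp hemb]; simp only [hcomp]
    _ = ∫ s : Ioi (0 : ℝ), ∫ θ : sphere (0 : X) 1, f (x + (s : ℝ) • (θ : X)) ∂μ.toSphere
          ∂.volumeIoiPow (Module.finrank ℝ X - 1) := integral_prod_symm _ hint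
    _ = ∫ s in Ioi (0 : ℝ), sphereIntegral μ f x s := integral_volumeIoiPow _ fun s ↦
      ∫ θ : sphere (0 : X) 1, f (x + s • (θ : X)) ∂μ.toSphere

theorem integral_norm_smul_eq_intervalIntegral [Nontrivial X] {k : ℝ → ℝ} {R : ℝ} (hR : 0 ≤ R)
    (hk : ∀ s, R ≤ s → k s = 0) (hint : Integrable (fun y ↦ k ‖y - x‖ • f y) μ) :
    ∫ y, k ‖y - x‖ • f y ∂μ = ∫ s in 0..R, k s • sphereIntegral μ f x s := by
  rw [integral_eq_integral_sphereIntegral hint x, intervalIntegral.integral_of_le hR]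
  rw [setIntegral_congr_fun measurableSet_Ioi fun s hs ↦
    sphereIntegral_norm_smul k f x (mem_Ioi.1 hs).le]
  refine setIntegral_eq_of_subset_of_forall_sdiff_eq_zero measurableSet_Ioi Ioc_subset_Ioi_self
    fun s hs ↦ ?_
  have hs' : R ≤ s := le_of_not_ge fun h ↦ hs.2 ⟨hs.1, h⟩
  rw [hk s hs', zero_smul]

theorem setIntegral_ball_eq_intervalIntegral [Nontrivial X] {R : ℝ} (hR : 0 ≤ R)
    (hf : IntegrableOn f (ball x R) μ) :
    ∫ y in ball x R, f y ∂μ = ∫ s in 0..R, sphereIntegral μ f x s := by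
  have hball : (fun y ↦ (Iio R).indicator (1 : ℝ → ℝ) ‖y - x‖ • f y) = (ball x R).indicator f := by
    ext y
    by_cases hy : ‖y - x‖ < R <;> simp [indicator, dist_eq_norm, hy]
  calc ∫ y in ball x R, f y ∂μ
      = ∫ y, (Iio R).indicator (1 : ℝ → ℝ) ‖y - x‖ • f y ∂μ := by
        rw [hball, integral_indicator measurableSet_ball]
    _ = ∫ s in 0..R, (Iio R).indicator (1 : ℝ → ℝ) s • sphereIntegral μ f x s :=
        integral_norm_smul_eq_intervalIntegral hR (fun s hs ↦ by simp [hs])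
          (by rwa [hball, integrable_indicator_iff measurableSet_ball])
    _ = ∫ s in 0..R, sphereIntegral μ f x s :=
        intervalIntegral.integral_congr_Ioo_of_le hR fun s hs ↦ by simp [hs.2]

theorem hasDerivAt_setIntegral_ball [CompleteSpace F] (hf : Continuous f) (x : X) {r : ℝ}
    (hr : 0 < r) :
    HasDerivAt (fun ρ ↦ ∫ y in ball x ρ, f y ∂μ) (sphereIntegral μ f x r) r := by
  cases subsingleton_or_nontrivial X
  · have hsphere : sphereIntegral μ f x r = 0 := by
      simp [sphereIntegral, μ.toSphere_eq_zero_iff.2 ‹_›]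
    rw [hsphere]
    refine (hasDerivAt_const r (∫ y, f y ∂μ)).congr_of_eventuallyEq ?_
    filter_upwards [lt_mem_nhds hr] with ρ hρ
    rw [Subsingleton.eq_univ_of_nonempty ⟨x, mem_ball_self hρ⟩, setIntegral_univ]
  · have hcont := continuous_sphereIntegral (μ := μ) hf x
    refine (hcont.integral_hasStrictDerivAt 0 r).hasDerivAt.congr_of_eventuallyEq ?_
    filter_upwards [lt_mem_nhds hr] with ρ hρ
    exact setIntegral_ball_eq_intervalIntegral hρ.le (integrableOn_ball hf x ρ)

end PolarCoordinates

section Divergence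

variable {X : Type*} [NormedAddCommGroup X]

/-- The divergence of a vector field on a normed space: the trace of its derivative. -/
def divergence [NormedSpace ℝ X] (W : X → X) (y : X) : ℝ :=
  LinearMap.trace ℝ X (fderiv ℝ W y)

section NormedSpace

variable [NormedSpace ℝ X] [FiniteDimensional ℝ X]

theorem continuous_divergence {W : X → X} (hW : ContDiff ℝ 1 W) : Continuous (divergence W) :=
  ((LinearMap.trace ℝ X).comp (ContinuousLinearMap.coeLM ℝ)).continuous_of_finiteDimensional.comp
    (hW.continuous_fderiv one_ne_zero)

omit [FiniteDimensional ℝ X] in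
theorem divergence_apply_sub {S : X → X →L[ℝ] X} {y : X} (hS : DifferentiableAt ℝ S y) (x : X) :
    divergence (fun z ↦ S z (z - x)) y =
      divergence (fun z ↦ S z (y - x)) y + LinearMap.trace ℝ X (S y) := by
  have hmoving : HasFDerivAt (fun z ↦ S z (z - x))
      (S y ∘L .id ℝ X + (fderiv ℝ S y).flip (y - x)) y :=
    hS.hasFDerivAt.clm_apply ((hasFDerivAt_id y).sub_const x)
  have hfixed := hS.hasFDerivAt.clm_apply (hasFDerivAt_const (y - x) y)
  simp only [divergence, hmoving.fderiv, hfixed.fderiv]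
  simp [add_comm]

theorem divergence_eq_sum_fderiv_repr {ι : Type*} [Fintype ι] (b : Module.Basis ι ℝ X)
    {W : X → X} {y : X} (hW : DifferentiableAt ℝ W y) :
    divergence W y = ∑ i, fderiv ℝ (fun z ↦ b.repr (W z) i) y (b i) := by
  classical
  have hrepr (i : ι) : HasFDerivAt (fun z ↦ b.repr (W z) i)
      ((b.coord i).toContinuousLinearMap ∘L fderiv ℝ W y) y :=
    (b.coord i).toContinuousLinearMap.hasFDerivAt.comp y hW.hasFDerivAt
  simp [divergence, LinearMap.trace_eq_matrix_trace ℝ b, Matrix.trace, LinearMap.toMatrix_apply,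
    fun i ↦ (hrepr i).fderiv]

theorem integral_mul_divergence [MeasurableSpace X] [BorelSpace X] {μ : Measure X}
    [μ.IsAddHaarMeasure] {η : X → ℝ} {W : X → X} (hη : ContDiff ℝ 1 η) (hsupp : HasCompactSupport η)
    (hW : ContDiff ℝ 1 W) :
    ∫ y, η y * divergence W y ∂μ = -∫ y, fderiv ℝ η y (W y) ∂μ := by
  set b := Module.finBasis ℝ X
  set w : Fin (Module.finrank ℝ X) → X → ℝ := fun i y ↦ b.repr (W y) i
  have hw (i) : ContDiff ℝ 1 (w i) := (b.coord i).toContinuousLinearMap.contDiff.comp hW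
  have hdη (y) : fderiv ℝ η y (W y) = ∑ i, fderiv ℝ η y (b i) * w i y := by
    conv_lhs => rw [← b.sum_repr (W y)]
    simp only [map_sum, map_smul, smul_eq_mul, mul_comm, w]
  have hwc (i) := (hw i).continuous
  have hηc := hη.continuous
  have hint_fderiv (i) : Integrable (fun y ↦ fderiv ℝ η y (b i) * w i y) μ :=
    Continuous.integrable_of_hasCompactSupport (by fun_prop)
      ((hsupp.fderiv_apply ℝ (b i)).mul_right)
  have hint_mul (i) : Integrable (fun y ↦ η y * fderiv ℝ (w i) y (b i)) μ :=
    Continuous.integrable_of_hasCompactSupport (by fun_prop) hsupp.mul_right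
  simp only [divergence_eq_sum_fderiv_repr b (hW.differentiable one_ne_zero _), hdη, Finset.mul_sum]
  rw [integral_finsetSum _ fun i _ ↦ hint_mul i, integral_finsetSum _ fun i _ ↦ hint_fderiv i,
    ← Finset.sum_neg_distrib]
  exact Finset.sum_congr rfl fun i _ ↦
    integral_mul_fderiv_eq_neg_fderiv_mul_of_integrable (hint_fderiv i) (hint_mul i)
      (Continuous.integrable_of_hasCompactSupport (by fun_prop) hsupp.mul_right)
      (fun y _ ↦ hη.differentiable one_ne_zero y) fun y _ ↦ (hw i).differentiable one_ne_zero y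

end NormedSpace

section InnerProductSpace

variable [InnerProductSpace ℝ X] [FiniteDimensional ℝ X] [MeasurableSpace X] [BorelSpace X]
  {μ : Measure X} [μ.IsAddHaarMeasure] {W : X → X}

omit [FiniteDimensional ℝ X] [MeasurableSpace X] [BorelSpace X] in
theorem fderiv_comp_norm_sub_sq_apply {h : ℝ → ℝ} {h' : ℝ} {x y v : X}
    (hh : HasDerivAt h h' (‖y - x‖ ^ 2)) :
    fderiv ℝ (fun z ↦ h (‖z - x‖ ^ 2)) y v = 2 * h' * ⟪v, y - x⟫ := by
  have hsq : HasFDerivAt (fun z : X ↦ ‖z - x‖ ^ 2) (2 • innerSL ℝ (y - x)) y := by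
    simpa using ((hasFDerivAt_id y).sub_const x).norm_sq
  have hcomp : HasFDerivAt (fun z ↦ h (‖z - x‖ ^ 2)) (h' • 2 • innerSL ℝ (y - x)) y :=
    hh.comp_hasFDerivAt y hsq
  simp only [hcomp.fderiv, smul_apply, innerSL_apply_apply, real_inner_comm v,
    smul_eq_mul, nsmul_eq_mul, Nat.cast_ofNat]
  ring

theorem intervalIntegral_mul_sphereIntegral_divergence [Nontrivial X] (hW : ContDiff ℝ 1 W)
    {h k : ℝ → ℝ} (hk : Continuous k) (hh : ∀ t, HasDerivAt h (k t) t) {R : ℝ} (hR : 0 ≤ R)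
    (hhR : ∀ t, R ^ 2 ≤ t → h t = 0) (hkR : ∀ t, R ^ 2 ≤ t → k t = 0) (x : X) :
    ∫ s in 0..R, h (s ^ 2) * sphereIntegral μ (divergence W) x s =
      -∫ s in 0..R, 2 * k (s ^ 2) * sphereIntegral μ (fun y ↦ ⟪W y, y - x⟫) x s := by
  have hderiv : deriv h = k := funext fun t ↦ (hh t).deriv
  have hhC : ContDiff ℝ 1 h :=
    contDiff_one_iff_deriv.2 ⟨fun t ↦ (hh t).differentiableAt, hderiv ▸ hk⟩
  have hsupp {f : ℝ → ℝ} (hf : ∀ t, R ^ 2 ≤ t → f t = 0) :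
      HasCompactSupport fun y : X ↦ f (‖y - x‖ ^ 2) := by
    refine HasCompactSupport.intro (isCompact_closedBall x R) fun y hy ↦ hf _ ?_
    have : R < ‖y - x‖ := by simpa [dist_eq_norm] using hy
    gcongr
  have hfderiv (y) := fun v ↦ fderiv_comp_norm_sub_sq_apply (x := x) (y := y) (v := v) (hh _)
  have hWc := hW.continuous
  have hdivc := continuous_divergence hW
  have hhc := hhC.continuous
  have hRsq {s : ℝ} (hs : R ≤ s) : R ^ 2 ≤ s ^ 2 := by gcongr
  have hparts := integral_mul_divergence (μ := μ) (η := fun y ↦ h (‖y - x‖ ^ 2))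
    (hhC.comp ((contDiff_id.sub contDiff_const).norm_sq ℝ)) (hsupp hhR) hW
  simp only [hfderiv] at hparts
  have hleft := integral_norm_smul_eq_intervalIntegral (μ := μ) (x := x) (f := divergence W)
    (k := fun s ↦ h (s ^ 2)) hR (fun s hs ↦ hhR _ (hRsq hs))
    (Continuous.integrable_of_hasCompactSupport (by fun_prop) (hsupp hhR).smul_right)
  have hright := integral_norm_smul_eq_intervalIntegral (μ := μ) (x := x)
    (f := fun y ↦ ⟪W y, y - x⟫) (k := fun s ↦ 2 * k (s ^ 2)) hR
    (fun s hs ↦ by rw [hkR _ (hRsq hs), mul_zero])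
    (Continuous.integrable_of_hasCompactSupport (by fun_prop)
      (HasCompactSupport.mul_left (f := fun _ ↦ 2) (hsupp hkR)).smul_right)
  simp only [smul_eq_mul] at hleft hright
  rw [← hleft, ← hright, hparts]

theorem intervalIntegral_mul_flux_sub_eq_zero [Nontrivial X] (hW : ContDiff ℝ 1 W) {γ : ℝ → ℝ}
    (hγ : Continuous γ) {R : ℝ} (hR : 0 ≤ R) (hγR : ∀ s, R ≤ s → γ s = 0) (x : X) :
    ∫ s in 0..R, γ s * (sphereIntegral μ (fun y ↦ ⟪W y, y - x⟫) x s -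
      s * ∫ t in 0..s, sphereIntegral μ (divergence W) x t) = 0 := by
  set B := sphereIntegral μ (fun y ↦ ⟪W y, y - x⟫) x
  set D := sphereIntegral μ (divergence W) x
  set I : ℝ → ℝ := fun s ↦ ∫ t in 0..s, D t
  -- Cutting off with an antiderivative of `γ ∘ √` at `‖y - x‖ ^ 2` lets `γ` be merely continuous
  -- and keeps the cutoff `C¹` at the centre `x`.
  set k : ℝ → ℝ := fun t ↦ γ √t
  set h : ℝ → ℝ := fun t ↦ ∫ u in R ^ 2..t, k u
  have hWc := hW.continuous
  have hB : Continuous B := continuous_sphereIntegral (by fun_prop) x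
  have hD : Continuous D := continuous_sphereIntegral (continuous_divergence hW) x
  have hI (s) : HasDerivAt I (D s) s := (hD.integral_hasStrictDerivAt 0 s).hasDerivAt
  have hIc : Continuous I := continuous_iff_continuousAt.2 fun s ↦ (hI s).continuousAt
  have hk : Continuous k := hγ.comp Real.continuous_sqrt
  have hh (t) : HasDerivAt h (k t) t := (hk.integral_hasStrictDerivAt (R ^ 2) t).hasDerivAt
  have hkR (t) (ht : R ^ 2 ≤ t) : k t = 0 := hγR _ (Real.le_sqrt_of_sq_le ht)
  have hhR (t) (ht : R ^ 2 ≤ t) : h t = 0 :=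
    intervalIntegral.integral_zero_ae (.of_forall fun u hu ↦ hkR u (uIoc_of_le ht ▸ hu).1.le)
  have hsq (s : ℝ) : HasDerivAt (fun s ↦ h (s ^ 2)) (k (s ^ 2) * (2 * s)) s :=
    HasDerivAt.comp (h₂ := h) s (hh (s ^ 2)) (by simpa using hasDerivAt_pow 2 s)
  have hdiv : ∫ s in 0..R, h (s ^ 2) * D s = -∫ s in 0..R, 2 * k (s ^ 2) * B s :=
    intervalIntegral_mul_sphereIntegral_divergence hW hk hh hR hhR hkR x
  have hparts : ∫ s in 0..R, h (s ^ 2) * D s = -∫ s in 0..R, k (s ^ 2) * (2 * s) * I s := by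
    rw [intervalIntegral.integral_mul_deriv_eq_deriv_mul (fun s _ ↦ hsq s) (fun s _ ↦ hI s)
      (Continuous.intervalIntegrable (by fun_prop) _ _) (hD.intervalIntegrable _ _), hhR _ le_rfl]
    simp [I]
  have hdiff : ∫ s in 0..R, (2 * k (s ^ 2) * B s - k (s ^ 2) * (2 * s) * I s) = 0 := by
    rw [intervalIntegral.integral_sub (Continuous.intervalIntegrable (by fun_prop) _ _)
      (Continuous.intervalIntegrable (by fun_prop) _ _)]
    linarith
  have hcongr : ∫ s in 0..R, (2 * k (s ^ 2) * B s - k (s ^ 2) * (2 * s) * I s) =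
      2 * ∫ s in 0..R, γ s * (B s - s * I s) := by
    rw [← intervalIntegral.integral_const_mul]
    refine intervalIntegral.integral_congr fun s hs ↦ ?_
    simp only [k, Real.sqrt_sq (uIcc_of_le hR ▸ hs).1]
    ring
  linarith

theorem eqOn_zero_of_forall_intervalIntegral_mul_eq_zero {q : ℝ → ℝ} (hq : Continuous q)
    (h : ∀ γ : ℝ → ℝ, Continuous γ → ∀ R, 0 ≤ R → (∀ s, R ≤ s → γ s = 0) →
      ∫ s in 0..R, γ s * q s = 0) : EqOn q 0 (Ici 0) := by
  intro r hr
  by_contra hne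
  have hr0 : 0 ≤ r := hr
  refine (intervalIntegral.integral_pos (a := 0) (b := r + 1)
    (f := fun s ↦ max 0 (r + 1 - s) * q s * q s) (by linarith)
    (Continuous.continuousOn (by fun_prop)) (fun s _ ↦ ?_) ⟨r, ⟨hr, by linarith⟩, ?_⟩).ne' ?_
  · rw [mul_assoc]
    exact mul_nonneg (le_max_left _ _) (mul_self_nonneg _)
  · simpa [mul_assoc] using hne
  · exact h _ (by fun_prop) _ (by linarith) fun s hs ↦ by simp [sub_nonpos.2 hs]

theorem sphereIntegral_inner_sub_eq_mul_integral_divergence (hW : ContDiff ℝ 1 W) (x : X) {r : ℝ}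
    (hr : 0 ≤ r) :
    sphereIntegral μ (fun y ↦ ⟪W y, y - x⟫) x r = r * ∫ y in ball x r, divergence W y ∂μ := by
  have hWc := hW.continuous
  have hdivc := continuous_divergence hW
  cases subsingleton_or_nontrivial X
  · simp [sphereIntegral, divergence, Subsingleton.elim _ (0 : X →ₗ[ℝ] X),
      μ.toSphere_eq_zero_iff.2 ‹_›]
  have hD : Continuous (sphereIntegral μ (divergence W) x) := continuous_sphereIntegral hdivc x
  set q : ℝ → ℝ := fun s ↦ sphereIntegral μ (fun y ↦ ⟪W y, y - x⟫) x s -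
    s * ∫ t in 0..s, sphereIntegral μ (divergence W) x t
  have hqc : Continuous q := (continuous_sphereIntegral (by fun_prop) x).sub
    (continuous_id.mul (intervalIntegral.continuous_primitive hD.intervalIntegrable 0))
  have hq0 : q r = 0 := eqOn_zero_of_forall_intervalIntegral_mul_eq_zero hqc
    (fun γ hγ R hR hγR ↦ intervalIntegral_mul_flux_sub_eq_zero hW hγ hR hγR x) hr
  rw [sub_eq_zero.1 hq0, setIntegral_ball_eq_intervalIntegral hr (integrableOn_ball hdivc x r)]

theorem setIntegral_ball_trace_of_divergence_eq_zero {S : X → X →L[ℝ] X} (hS : ContDiff ℝ 1 S)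
    (hdiv : ∀ w y, divergence (fun z ↦ S z w) y = 0) (x : X) {r : ℝ} (hr : 0 < r) :
    ∫ y in ball x r, LinearMap.trace ℝ X (S y) ∂μ =
      r * sphereIntegral μ
        (fun y ↦ ⟪S y (‖y - x‖⁻¹ • (y - x)), ‖y - x‖⁻¹ • (y - x)⟫) x r := by
  have htrace (y) : divergence (fun z ↦ S z (z - x)) y = LinearMap.trace ℝ X (S y) := by
    rw [divergence_apply_sub (hS.differentiable one_ne_zero y), hdiv, zero_add]
  have hflux := sphereIntegral_inner_sub_eq_mul_integral_divergence (μ := μ)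
    (W := fun z ↦ S z (z - x)) (hS.clm_apply (contDiff_id.sub contDiff_const)) x hr.le
  have hnormal (y : X) : ⟪S y (‖y - x‖⁻¹ • (y - x)), ‖y - x‖⁻¹ • (y - x)⟫ =
      (‖y - x‖⁻¹ * ‖y - x‖⁻¹) • ⟪S y (y - x), y - x⟫ := by
    simp only [map_smul, inner_smul_left, inner_smul_right, conj_trivial, smul_eq_mul, mul_assoc]
  simp only [hnormal]
  rw [sphereIntegral_norm_smul (fun s ↦ s⁻¹ * s⁻¹) _ x hr.le]
  simp only [htrace] at hflux
  rw [hflux, smul_eq_mul]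
  field_simp

end InnerProductSpace

end Divergence

section PullbackMetric

variable {X F H N : Type*} [NormedAddCommGroup X] [NormedSpace ℝ X]
  [NormedAddCommGroup F] [NormedSpace ℝ F] [TopologicalSpace H] {I : ModelWithCorners ℝ F H}
  [TopologicalSpace N] [ChartedSpace H N]
  [Bundle.RiemannianBundle (fun q : N ↦ TangentSpace I q)]

variable (I) in
/-- The Riemannian metric of `N` at `q`, as a bilinear form on the model space `F`, of which the
tangent space at `q` is a type synonym. -/
def bundleMetric (q : N) : F →L[ℝ] F →L[ℝ] ℝ :=
  innerSL ℝ (E := TangentSpace I q)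

variable (I) in
/-- The pullback `f*g` of the Riemannian metric of `N` under a map `f` defined on a normed space, as
a field of bilinear forms: `(f*g)_y(v, w) = ⟨df_y v, df_y w⟩`. -/
def pullbackMetric (f : X → N) (y : X) : X →L[ℝ] X →L[ℝ] ℝ :=
  (bundleMetric I (f y)).bilinearComp (mfderiv 𝓘(ℝ, X) I f y : X →L[ℝ] F)
    (mfderiv 𝓘(ℝ, X) I f y : X →L[ℝ] F)

theorem pullbackMetric_comm (f : X → N) (y v w : X) :
    pullbackMetric I f y v w = pullbackMetric I f y w v :=
  real_inner_comm (F := TangentSpace I (f y)) _ _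

theorem pullbackMetric_self (f : X → N) (y v : X) :
    pullbackMetric I f y v v = ‖mfderiv 𝓘(ℝ, X) I f y v‖ ^ 2 :=
  real_inner_self_eq_norm_sq (F := TangentSpace I (f y)) _

theorem pullbackMetric_congr {f g : X → N} {y : X} (h : f =ᶠ[𝓝 y] g) :
    pullbackMetric I f y = pullbackMetric I g y := by
  have hd : (mfderiv 𝓘(ℝ, X) I f y : X →L[ℝ] F) = mfderiv 𝓘(ℝ, X) I g y := h.mfderiv_eq
  rw [pullbackMetric, pullbackMetric, h.self_of_nhds, hd]

variable {Y : Type*} [NormedAddCommGroup Y] [NormedSpace ℝ Y]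

theorem pullbackMetric_comp {f : Y → N} {u : X → Y} {y : X}
    (hf : MDifferentiableAt 𝓘(ℝ, Y) I f (u y)) (hu : DifferentiableAt ℝ u y) :
    pullbackMetric I (f ∘ u) y =
      (pullbackMetric I f (u y)).bilinearComp (fderiv ℝ u y) (fderiv ℝ u y) := by
  have hd : (mfderiv 𝓘(ℝ, X) I (f ∘ u) y : X →L[ℝ] F) =
      (mfderiv 𝓘(ℝ, Y) I f (u y) : Y →L[ℝ] F) ∘L fderiv ℝ u y := by
    have hcomp := mfderiv_comp y hf hu.mdifferentiableAt
    rwa [mfderiv_eq_fderiv] at hcomp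
  rw [pullbackMetric, hd]
  rfl

omit [Bundle.RiemannianBundle (fun q : N ↦ TangentSpace I q)] in
theorem contMDiffOn_mfderiv_apply [IsManifold I 1 N] {k l : WithTop ℕ∞} {f : X → N} {s : Set X}
    (hkl : k + 1 ≤ l) (hs : IsOpen s) (hf : ContMDiffOn 𝓘(ℝ, X) I l f s) (v : X) :
    ContMDiffOn 𝓘(ℝ, X) I.tangent k
      (fun y ↦ (⟨f y, mfderiv 𝓘(ℝ, X) I f y v⟩ : TangentBundle I N)) s := by
  have htangent := hf.contMDiffOn_tangentMapWithin hkl hs.uniqueMDiffOn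
  have hconst : ContMDiff 𝓘(ℝ, X) 𝓘(ℝ, X).tangent k
      (fun y : X ↦ (⟨y, v⟩ : TangentBundle 𝓘(ℝ, X) X)) :=
    contMDiff_vectorSpace_iff_contDiff.2 contDiff_const
  refine (htangent.comp hconst.contMDiffOn fun y hy ↦ hy).congr fun y hy ↦ ?_
  simp only [Function.comp_apply, tangentMapWithin, mfderivWithin_of_isOpen hs hy]

theorem contDiffOn_pullbackMetric [FiniteDimensional ℝ X] [IsManifold I 1 N] {k l : WithTop ℕ∞}
    [IsContMDiffRiemannianBundle I k F (fun q : N ↦ TangentSpace I q)]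
    {f : X → N} {s : Set X} (hkl : k + 1 ≤ l) (hs : IsOpen s) (hf : ContMDiffOn 𝓘(ℝ, X) I l f s) :
    ContDiffOn ℝ k (pullbackMetric I f) s := by
  refine contDiffOn_clm_apply.2 fun v ↦ contDiffOn_clm_apply.2 fun w ↦ ?_
  have hinner := ContMDiffOn.inner_bundle (E := fun q : N ↦ TangentSpace I q)
    (contMDiffOn_mfderiv_apply hkl hs hf v) (contMDiffOn_mfderiv_apply hkl hs hf w)
  exact contMDiffOn_iff_contDiffOn.1 hinner

end PullbackMetric

section BilinearForm

variable {X Y : Type*} [NormedAddCommGroup X] [NormedSpace ℝ X] [NormedAddCommGroup Y]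
  [NormedSpace ℝ Y] {G : Y → Y →L[ℝ] Y →L[ℝ] ℝ} {u : X → Y} {y : X}

set_option synthInstance.maxHeartbeats 40000 in
-- Instances on `Y →L[ℝ] Y →L[ℝ] ℝ` exceed the default search limit.
theorem fderiv_bilin_fderiv_apply (hG : DifferentiableAt ℝ G (u y)) (hu : ContDiffAt ℝ 2 u y)
    (a b c : X) :
    fderiv ℝ (fun z ↦ G (u z) (fderiv ℝ u z b) (fderiv ℝ u z c)) y a =
      fderiv ℝ G (u y) (fderiv ℝ u y a) (fderiv ℝ u y b) (fderiv ℝ u y c) +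
        G (u y) (fderiv ℝ (fderiv ℝ u) y a b) (fderiv ℝ u y c) +
        G (u y) (fderiv ℝ u y b) (fderiv ℝ (fderiv ℝ u) y a c) := by
  have hGu : HasFDerivAt (fun z ↦ G (u z)) (fderiv ℝ G (u y) ∘L fderiv ℝ u y) y :=
    HasFDerivAt.comp (g := G) y hG.hasFDerivAt (hu.differentiableAt two_ne_zero).hasFDerivAt
  have hDu (v : X) : HasFDerivAt (fun z ↦ fderiv ℝ u z v) ((fderiv ℝ (fderiv ℝ u) y).flip v) y := by
    have hD : DifferentiableAt ℝ (fderiv ℝ u) y :=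
      (hu.fderiv_right (m := 1) (by norm_num)).differentiableAt one_ne_zero
    simpa using hD.hasFDerivAt.clm_apply (hasFDerivAt_const v y)
  rw [((hGu.clm_apply (hDu b)).clm_apply (hDu c)).fderiv]
  simp only [ContinuousLinearMap.flip_add, add_apply, ContinuousLinearMap.comp_apply,
    ContinuousLinearMap.flip_apply]
  ring

/-- The Christoffel symbols of the first kind come from the last two terms: in this combination the
second derivatives of `u` survive only through `D²u(v, v)`. -/
theorem fderiv_bilin_fderiv_sub_half (hG : DifferentiableAt ℝ G (u y))
    (hsymm : ∀ v w, G (u y) v w = G (u y) w v) (hu : ContDiffAt ℝ 2 u y) (v w : X) :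
    fderiv ℝ (fun z ↦ G (u z) (fderiv ℝ u z v) (fderiv ℝ u z w)) y v -
        1 / 2 * fderiv ℝ (fun z ↦ G (u z) (fderiv ℝ u z v) (fderiv ℝ u z v)) y w =
      G (u y) (fderiv ℝ (fderiv ℝ u) y v v) (fderiv ℝ u y w) +
        (fderiv ℝ G (u y) (fderiv ℝ u y v) (fderiv ℝ u y v) (fderiv ℝ u y w) -
          1 / 2 * fderiv ℝ G (u y) (fderiv ℝ u y w) (fderiv ℝ u y v) (fderiv ℝ u y v)) := by
  have hD : fderiv ℝ (fderiv ℝ u) y w v = fderiv ℝ (fderiv ℝ u) y v w :=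
    hu.isSymmSndFDerivAt (by simp) w v
  rw [fderiv_bilin_fderiv_apply hG hu, fderiv_bilin_fderiv_apply hG hu, hD,
    hsymm (fderiv ℝ (fderiv ℝ u) y v w)]
  ring

end BilinearForm

section Chart

variable {m : ℕ}

theorem coe_basisFun : ⇑(EuclideanSpace.basisFun (Fin m) ℝ) = stdVec :=
  funext fun i ↦ EuclideanSpace.basisFun_apply (Fin m) ℝ i

theorem sum_apply_smul_stdVec (v : E m) : ∑ a, v a • stdVec a = v := by
  simpa [stdVec] using (EuclideanSpace.basisFun (Fin m) ℝ).sum_repr v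

variable {X : Type*} [NormedAddCommGroup X] [NormedSpace ℝ X]
  {N : Type*} [TopologicalSpace N] [ChartedSpace (E m) N]

theorem mfderiv_extChartAt_symm_self [IsManifold (𝓡 m) 1 N] (p : N) :
    (mfderiv (𝓡 m) (𝓡 m) (extChartAt (𝓡 m) p).symm (extChartAt (𝓡 m) p p) : E m →L[ℝ] E m) =
      ContinuousLinearMap.id ℝ (E m) := by
  have h := mfderivWithin_range_extChartAt_symm (I := 𝓡 m) (x := p)
  rwa [ModelWithCorners.Boundaryless.range_eq_univ, mfderivWithin_univ] at h

theorem mfderiv_eq_fderiv_extChartAt [IsManifold (𝓡 m) 1 N] {φ : X → N} {x : X}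
    (hφ : MDifferentiableAt 𝓘(ℝ, X) (𝓡 m) φ x) :
    (mfderiv 𝓘(ℝ, X) (𝓡 m) φ x : X →L[ℝ] E m) =
      fderiv ℝ (fun y ↦ extChartAt (𝓡 m) (φ x) (φ y)) x := by
  have hcomp := mfderiv_comp x
    (mdifferentiableAt_extChartAt (I := 𝓡 m) (mem_chart_source (E m) (φ x))) hφ
  rw [mfderiv_extChartAt_self, mfderiv_eq_fderiv] at hcomp
  exact hcomp.symm

variable [Bundle.RiemannianBundle (fun q : N ↦ TangentSpace (𝓡 m) q)]

theorem inner_grad_mfderiv {V : N → ℝ} {φ : X → N} {x : X}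
    (hV : MDifferentiableAt (𝓡 m) 𝓘(ℝ, ℝ) V (φ x)) (hφ : MDifferentiableAt 𝓘(ℝ, X) (𝓡 m) φ x)
    (w : X) :
    inner ℝ (grad V (φ x)) (mfderiv 𝓘(ℝ, X) (𝓡 m) φ x w) = fderiv ℝ (fun y ↦ V (φ y)) x w := by
  have hchain := mfderiv_comp x hV hφ
  rw [mfderiv_eq_fderiv] at hchain
  have : FiniteDimensional ℝ (TangentSpace (𝓡 m) (φ x)) :=
    inferInstanceAs (FiniteDimensional ℝ (E m))
  have : CompleteSpace (TangentSpace (𝓡 m) (φ x)) := FiniteDimensional.complete ℝ _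
  exact (InnerProductSpace.toDual_symm_apply (𝕜 := ℝ) (E := TangentSpace (𝓡 m) (φ x))).trans
    (congrArg (fun L : X →L[ℝ] ℝ ↦ L w) hchain).symm

/-- The Riemannian metric of `N` in the chart around `p`, as a field of bilinear forms on the
coordinate space: the coordinate-free version of `metricMatrix`. -/
def chartMetric (p : N) : E m → E m →L[ℝ] E m →L[ℝ] ℝ :=
  pullbackMetric (𝓡 m) (extChartAt (𝓡 m) p).symm

theorem chartMetric_stdVec (p : N) (y : E m) (a b : Fin m) :
    chartMetric p y (stdVec a) (stdVec b) = metricMatrix p y a b :=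
  rfl

variable [IsManifold (𝓡 m) 1 N]

theorem chartMetric_self (p : N) :
    chartMetric p (extChartAt (𝓡 m) p p) = bundleMetric (𝓡 m) p := by
  rw [chartMetric, pullbackMetric, mfderiv_extChartAt_symm_self, extChartAt_to_inv]
  rfl

theorem det_metricMatrix_self_ne_zero (p : N) :
    (metricMatrix p (extChartAt (𝓡 m) p p)).det ≠ 0 := by
  have hindep : LinearIndependent ℝ (stdVec : Fin m → E m) := by
    rw [← coe_basisFun]
    exact (EuclideanSpace.basisFun (Fin m) ℝ).orthonormal.linearIndependent
  have hgram : metricMatrix p (extChartAt (𝓡 m) p p) =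
      Matrix.gram (E := TangentSpace (𝓡 m) p) ℝ stdVec := by
    ext a b
    rw [← chartMetric_stdVec, chartMetric_self]
    exact (Matrix.gram_apply (E := TangentSpace (𝓡 m) p) stdVec a b).symm
  rw [hgram]
  exact Matrix.det_gram_ne_zero_iff_linearIndependent.2 hindep

theorem pullbackMetric_eventuallyEq {φ : X → N} (hφ : MDifferentiable 𝓘(ℝ, X) (𝓡 m) φ) (x : X) :
    let u : X → E m := fun y ↦ extChartAt (𝓡 m) (φ x) (φ y)
    pullbackMetric (𝓡 m) φ =ᶠ[𝓝 x]
      fun y ↦ (chartMetric (φ x) (u y)).bilinearComp (fderiv ℝ u y) (fderiv ℝ u y) := by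
  intro u
  set ψ := extChartAt (𝓡 m) (φ x)
  have hsource : ∀ᶠ y in 𝓝 x, φ y ∈ ψ.source :=
    (hφ x).continuousAt.preimage_mem_nhds (extChartAt_source_mem_nhds (φ x))
  filter_upwards [hsource.eventually_nhds] with y hy
  have hyψ : φ y ∈ ψ.source := hy.self_of_nhds
  have hu : DifferentiableAt ℝ u y :=
    ((mdifferentiableAt_extChartAt (by simpa [ψ] using hyψ)).comp y (hφ y)).differentiableAt
  have hψ : MDifferentiableAt (𝓡 m) (𝓡 m) ψ.symm (u y) :=
    ((contMDiffOn_extChartAt_symm (n := 1) (φ x)).contMDiffAt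
      ((isOpen_extChartAt_target (φ x)).mem_nhds (ψ.map_source hyψ))).mdifferentiableAt one_ne_zero
  rw [pullbackMetric_congr (hy.mono fun z hz ↦ (ψ.left_inv hz).symm)]
  exact pullbackMetric_comp hψ hu

end Chart

section Tension

variable {n m : ℕ} {N : Type*} [TopologicalSpace N] [ChartedSpace (E m) N]
  [Bundle.RiemannianBundle (fun q : N ↦ TangentSpace (𝓡 m) q)]

/-- The quadratic Christoffel term `Γ_y(v, v)` of the Levi-Civita connection in the chart around
`p`: the vector with components `∑_{a,b} Γᶜ_{ab}(y) vᵃ vᵇ`. -/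
def christoffelQuadratic (p : N) (y v : E m) : E m :=
  WithLp.toLp 2 fun c ↦ ∑ a, ∑ b, christoffel p y c a b * v a * v b

theorem clm_apply_eq_sum_stdVec {Z : Type*} [AddCommGroup Z] [Module ℝ Z] [TopologicalSpace Z]
    (L : E m →L[ℝ] Z) (v : E m) : L v = ∑ a, v a • L (stdVec a) := by
  conv_lhs => rw [← sum_apply_smul_stdVec v]
  simp only [map_sum, map_smul]

theorem bilin_apply_eq_sum_stdVec {Z : Type*} [NormedAddCommGroup Z] [NormedSpace ℝ Z]
    (B : E m →L[ℝ] E m →L[ℝ] Z) (v w : E m) :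
    B v w = ∑ a, ∑ b, (v a * w b) • B (stdVec a) (stdVec b) := by
  simp only [clm_apply_eq_sum_stdVec B v, sum_apply, smul_apply]
  simp only [clm_apply_eq_sum_stdVec _ w, Finset.smul_sum, mul_smul]

theorem laplacian_eq_sum_fderiv_fderiv (u : E n → E m) (x : E n) :
    Laplacian.laplacian u x = ∑ i, fderiv ℝ (fderiv ℝ u) x (stdVec i) (stdVec i) := by
  rw [InnerProductSpace.laplacian_eq_iteratedFDeriv_orthonormalBasis u
    (EuclideanSpace.basisFun (Fin n) ℝ)]
  simp [iteratedFDeriv_two_apply, stdVec]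

theorem tension_eq_sum [IsManifold (𝓡 m) 1 N] (φ : E n → N) (x : E n) :
    let u : E n → E m := fun y ↦ extChartAt (𝓡 m) (φ x) (φ y)
    (tension (m := m) φ x : E m) = ∑ i, (fderiv ℝ (fderiv ℝ u) x (stdVec i) (stdVec i) +
      christoffelQuadratic (φ x) (u x) (fderiv ℝ u x (stdVec i))) := by
  intro u
  have hcoord : (tension (m := m) φ x : E m) =
      ∑ c, tensionCoord (m := m) φ x c • (stdVec c : E m) := by
    rw [tension, mfderiv_extChartAt_self]
    refine Finset.sum_congr rfl fun c _ ↦ congrArg (tensionCoord φ x c • ·) ?_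
    exact congrArg (fun L : E m →L[ℝ] E m ↦ L (stdVec c)) ContinuousLinearMap.inverse_id
  rw [hcoord, Finset.sum_add_distrib, ← laplacian_eq_sum_fderiv_fderiv,
    ← sum_apply_smul_stdVec (_ + _)]
  refine Finset.sum_congr rfl fun c _ ↦ congrArg (· • stdVec c) ?_
  simp [tensionCoord, christoffelQuadratic, u]

theorem bundleMetric_stdVec_right [IsManifold (𝓡 m) 1 N] (p : N) (Γ : E m) (d : Fin m) :
    bundleMetric (𝓡 m) p Γ (stdVec d) =
      (metricMatrix p (extChartAt (𝓡 m) p p)).mulVec Γ d := by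
  have hsymm : bundleMetric (𝓡 m) p Γ (stdVec d) = bundleMetric (𝓡 m) p (stdVec d) Γ :=
    real_inner_comm (F := TangentSpace (𝓡 m) p) _ _
  conv_lhs => rw [hsymm, ← sum_apply_smul_stdVec Γ, map_sum]
  refine Finset.sum_congr rfl fun c _ ↦ ?_
  rw [map_smul, ← chartMetric_self, chartMetric_stdVec, smul_eq_mul, mul_comm]

variable [IsManifold (𝓡 m) 2 N]
  [IsContMDiffRiemannianBundle (𝓡 m) 1 (E m) (fun q : N ↦ TangentSpace (𝓡 m) q)]

theorem differentiableAt_chartMetric (p : N) :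
    DifferentiableAt ℝ (chartMetric p) (extChartAt (𝓡 m) p p) := by
  have htarget := isOpen_extChartAt_target (I := 𝓡 m) p
  have hC1 : ContDiffOn ℝ 1 (chartMetric p) (extChartAt (𝓡 m) p).target :=
    contDiffOn_pullbackMetric (by norm_num) htarget (contMDiffOn_extChartAt_symm (n := 2) p)
  exact (hC1.contDiffAt (htarget.mem_nhds (mem_extChartAt_target p))).differentiableAt one_ne_zero

theorem dMetric_self_eq (p : N) (c a b : Fin m) :
    dMetric p (extChartAt (𝓡 m) p p) c a b =
      fderiv ℝ (chartMetric p) (extChartAt (𝓡 m) p p) (stdVec c) (stdVec a) (stdVec b) := by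
  have hG := ((differentiableAt_chartMetric p).hasFDerivAt.clm_apply
    (hasFDerivAt_const (stdVec a) _)).clm_apply (hasFDerivAt_const (stdVec b) _)
  have hderiv := congrArg (fun L : E m →L[ℝ] ℝ ↦ L (stdVec c)) hG.fderiv
  exact hderiv.trans (by simp)

theorem christoffelQuadratic_self_eq (p : N) (v : E m) :
    let D := fderiv ℝ (chartMetric p) (extChartAt (𝓡 m) p p)
    christoffelQuadratic p (extChartAt (𝓡 m) p p) v =
      WithLp.toLp 2 ((metricMatrix p (extChartAt (𝓡 m) p p))⁻¹.mulVec
        fun d ↦ D v v (stdVec d) - 1 / 2 * D (stdVec d) v v) := by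
  intro D
  have hleft (d : Fin m) :
      D v v (stdVec d) = ∑ a, ∑ b, v a * v b * D (stdVec a) (stdVec b) (stdVec d) := by
    rw [bilin_apply_eq_sum_stdVec D v v]
    simp only [sum_apply, smul_apply, smul_eq_mul]
  have hright (d : Fin m) :
      D (stdVec d) v v = ∑ a, ∑ b, v a * v b * D (stdVec d) (stdVec a) (stdVec b) :=
    bilin_apply_eq_sum_stdVec (D (stdVec d)) v v
  have hsymm (d : Fin m) :
      ∑ a, ∑ b, v a * v b * D (stdVec b) (stdVec a) (stdVec d) =
        ∑ a, ∑ b, v a * v b * D (stdVec a) (stdVec b) (stdVec d) := by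
    rw [Finset.sum_comm]
    simp only [mul_comm (v _) (v _)]
  have hentry (d : Fin m) : D v v (stdVec d) - 1 / 2 * D (stdVec d) v v =
      ∑ a, ∑ b, 1 / 2 * (D (stdVec a) (stdVec b) (stdVec d) +
        D (stdVec b) (stdVec a) (stdVec d) - D (stdVec d) (stdVec a) (stdVec b)) * v a * v b := by
    have hdouble : D v v (stdVec d) = 1 / 2 * (D v v (stdVec d) + D v v (stdVec d)) := by ring
    rw [hdouble, hleft d]
    nth_rw 2 [← hsymm d]
    rw [hright d]
    simp only [Finset.mul_sum, ← Finset.sum_add_distrib, ← Finset.sum_sub_distrib]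
    exact Finset.sum_congr rfl fun a _ ↦ Finset.sum_congr rfl fun b _ ↦ by ring
  ext c
  simp only [christoffelQuadratic, christoffel, dMetric_self_eq, Matrix.mulVec, dotProduct, hentry,
    Finset.mul_sum, Finset.sum_mul]
  rw [Finset.sum_congr rfl fun a _ ↦ Finset.sum_comm, Finset.sum_comm]
  refine Finset.sum_congr rfl fun d _ ↦ Finset.sum_congr rfl fun a _ ↦
    Finset.sum_congr rfl fun b _ ↦ ?_
  ring

set_option synthInstance.maxHeartbeats 40000 in
-- Instances on `E m →L[ℝ] E m →L[ℝ] ℝ` exceed the default search limit.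
theorem bundleMetric_christoffelQuadratic (p : N) (v w : E m) :
    let D := fderiv ℝ (chartMetric p) (extChartAt (𝓡 m) p p)
    bundleMetric (𝓡 m) p (christoffelQuadratic p (extChartAt (𝓡 m) p p) v) w =
      D v v w - 1 / 2 * D w v v := by
  intro D
  have hstd (d : Fin m) : bundleMetric (𝓡 m) p
      (christoffelQuadratic p (extChartAt (𝓡 m) p p) v) (stdVec d) =
        D v v (stdVec d) - 1 / 2 * D (stdVec d) v v := by
    rw [bundleMetric_stdVec_right, christoffelQuadratic_self_eq, Matrix.mulVec_mulVec,
      Matrix.mul_nonsing_inv _ (isUnit_iff_ne_zero.2 (det_metricMatrix_self_ne_zero p)),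
      Matrix.one_mulVec]
  have hD : D w = ∑ d, w d • D (stdVec d) :=
    clm_apply_eq_sum_stdVec (Z := E m →L[ℝ] E m →L[ℝ] ℝ) D w
  rw [clm_apply_eq_sum_stdVec _ w, clm_apply_eq_sum_stdVec (D v v) w, hD]
  simp only [hstd, sum_apply, smul_apply, smul_eq_mul, Finset.mul_sum, ← Finset.sum_sub_distrib]
  exact Finset.sum_congr rfl fun d _ ↦ by ring

end Tension

section StressTensor

variable {n m : ℕ} {N : Type*} [TopologicalSpace N] [ChartedSpace (E m) N]
  [Bundle.RiemannianBundle (fun q : N ↦ TangentSpace (𝓡 m) q)]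
  {V : N → ℝ} {φ : E n → N}

theorem inner_tension_mfderiv [IsManifold (𝓡 m) 2 N]
    [IsContMDiffRiemannianBundle (𝓡 m) 1 (E m) (fun q : N ↦ TangentSpace (𝓡 m) q)]
    (hφ : ContMDiff (𝓡 n) (𝓡 m) 2 φ) (x w : E n) :
    inner ℝ (tension (m := m) φ x) (mfderiv (𝓡 n) (𝓡 m) φ x w) =
      ∑ i, (fderiv ℝ (fun z ↦ pullbackMetric (𝓡 m) φ z (stdVec i) w) x (stdVec i) -
        1 / 2 * fderiv ℝ (fun z ↦ pullbackMetric (𝓡 m) φ z (stdVec i) (stdVec i)) x w) := by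
  let u : E n → E m := fun y ↦ extChartAt (𝓡 m) (φ x) (φ y)
  have hu2 : ContDiffAt ℝ 2 u x :=
    ((contMDiffAt_extChartAt (n := 2)).comp x (hφ x)).contDiffAt
  have hlocal (v v' : E n) : (fun z ↦ pullbackMetric (𝓡 m) φ z v v') =ᶠ[𝓝 x]
      fun z ↦ chartMetric (φ x) (u z) (fderiv ℝ u z v) (fderiv ℝ u z v') :=
    (pullbackMetric_eventuallyEq (hφ.mdifferentiable two_ne_zero) x).mono fun z hz ↦
      congrArg (fun B : E n →L[ℝ] E n →L[ℝ] ℝ ↦ B v v') hz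
  have hmf : (mfderiv (𝓡 n) (𝓡 m) φ x : E n →L[ℝ] E m) = fderiv ℝ u x :=
    mfderiv_eq_fderiv_extChartAt (hφ.mdifferentiable two_ne_zero x)
  have hinner : inner ℝ (tension (m := m) φ x) (mfderiv (𝓡 n) (𝓡 m) φ x w) =
      bundleMetric (𝓡 m) (φ x) (tension (m := m) φ x : E m) (fderiv ℝ u x w) := by
    rw [← hmf]
    rfl
  rw [hinner, tension_eq_sum, map_sum, sum_apply]
  refine Finset.sum_congr rfl fun i _ ↦ ?_
  have hsplit := fderiv_bilin_fderiv_sub_half (G := chartMetric (φ x)) (u := u)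
    (differentiableAt_chartMetric (φ x)) (pullbackMetric_comm _ _) hu2 (stdVec i) w
  rw [(hlocal _ _).fderiv_eq, (hlocal _ _).fderiv_eq, hsplit, map_add, add_apply,
    bundleMetric_christoffelQuadratic, chartMetric_self]

/-- The stress-energy tensor `S = e(φ) g₀ - φ*g` of a map `φ : ℝⁿ → N` with potential `V`, where
`e(φ)` is the energy density and `g₀` the Euclidean metric, as a field of endomorphisms of `ℝⁿ`. -/
def stressTensor (V : N → ℝ) (φ : E n → N) (y : E n) : E n →L[ℝ] E n :=
  energyDensity (m := m) V φ y • ContinuousLinearMap.id ℝ (E n) -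
    ∑ i, (pullbackMetric (𝓡 m) φ y (stdVec i)).smulRight (stdVec i)

theorem energyDensity_eq_pullbackMetric (V : N → ℝ) (φ : E n → N) (y : E n) :
    energyDensity (m := m) V φ y =
      1 / 2 * ∑ i, pullbackMetric (𝓡 m) φ y (stdVec i) (stdVec i) - V (φ y) := by
  simp only [energyDensity, normSqDiff, pullbackMetric_self]

theorem stressTensor_apply_apply (V : N → ℝ) (φ : E n → N) (y w : E n) (j : Fin n) :
    stressTensor (m := m) V φ y w j =
      energyDensity (m := m) V φ y * w j - pullbackMetric (𝓡 m) φ y (stdVec j) w := by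
  simp [stressTensor, stdVec, Pi.single_apply]

theorem trace_stressTensor (V : N → ℝ) (φ : E n → N) (y : E n) :
    LinearMap.trace ℝ (E n) (stressTensor (m := m) V φ y) =
      (n - 2) * energyDensity (m := m) V φ y - 2 * V (φ y) := by
  have hentry (i : Fin n) : stressTensor (m := m) V φ y (stdVec i) i =
      energyDensity (m := m) V φ y - pullbackMetric (𝓡 m) φ y (stdVec i) (stdVec i) := by
    rw [stressTensor_apply_apply]
    simp [stdVec]
  simp only [LinearMap.trace_eq_sum_inner _ (EuclideanSpace.basisFun (Fin n) ℝ),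
    EuclideanSpace.basisFun_inner, ContinuousLinearMap.coe_coe]
  simp only [coe_basisFun, hentry, Finset.sum_sub_distrib, Finset.sum_const, Finset.card_univ,
    Fintype.card_fin, nsmul_eq_mul]
  linear_combination 2 * energyDensity_eq_pullbackMetric (m := m) V φ y

theorem inner_stressTensor (V : N → ℝ) (φ : E n → N) (y w : E n) :
    ⟪stressTensor (m := m) V φ y w, w⟫ =
      energyDensity (m := m) V φ y * ‖w‖ ^ 2 - ‖mfderiv (𝓡 n) (𝓡 m) φ y w‖ ^ 2 := by
  have hexpand := congrArg (fun L : E n →L[ℝ] ℝ ↦ L w)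
    (clm_apply_eq_sum_stdVec (pullbackMetric (𝓡 m) φ y) w)
  simp only [pullbackMetric_self, sum_apply, smul_apply, smul_eq_mul] at hexpand
  rw [hexpand, PiLp.inner_apply, EuclideanSpace.real_norm_sq_eq, Finset.mul_sum,
    ← Finset.sum_sub_distrib]
  refine Finset.sum_congr rfl fun j _ ↦ ?_
  rw [stressTensor_apply_apply]
  simp only [RCLike.inner_apply, Real.ringHom_apply]
  ring

variable [IsManifold (𝓡 m) 2 N]
  [IsContMDiffRiemannianBundle (𝓡 m) 1 (E m) (fun q : N ↦ TangentSpace (𝓡 m) q)]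

theorem contDiff_pullbackMetric (hφ : ContMDiff (𝓡 n) (𝓡 m) 2 φ) :
    ContDiff ℝ 1 (pullbackMetric (𝓡 m) φ) :=
  contDiffOn_univ.1 (contDiffOn_pullbackMetric (l := 2) (by norm_num) isOpen_univ hφ.contMDiffOn)

theorem contDiff_pullbackMetric_apply (hφ : ContMDiff (𝓡 n) (𝓡 m) 2 φ) (v w : E n) :
    ContDiff ℝ 1 fun y ↦ pullbackMetric (𝓡 m) φ y v w :=
  ((contDiff_pullbackMetric hφ).clm_apply contDiff_const).clm_apply contDiff_const

theorem contDiff_energyDensity (hV : ContMDiff (𝓡 m) 𝓘(ℝ, ℝ) 1 V)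
    (hφ : ContMDiff (𝓡 n) (𝓡 m) 2 φ) : ContDiff ℝ 1 (energyDensity (m := m) V φ) := by
  have hVφ : ContDiff ℝ 1 (fun y ↦ V (φ y)) := (hV.comp (hφ.of_le one_le_two)).contDiff
  rw [funext (energyDensity_eq_pullbackMetric V φ)]
  exact (contDiff_const.mul (.sum fun i _ ↦ contDiff_pullbackMetric_apply hφ _ _)).sub hVφ

theorem contDiff_stressTensor (hV : ContMDiff (𝓡 m) 𝓘(ℝ, ℝ) 1 V)
    (hφ : ContMDiff (𝓡 n) (𝓡 m) 2 φ) : ContDiff ℝ 1 (stressTensor (m := m) V φ) := by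
  have he := contDiff_energyDensity hV hφ
  have hh := contDiff_pullbackMetric hφ
  unfold stressTensor
  fun_prop

theorem fderiv_energyDensity (hV : ContMDiff (𝓡 m) 𝓘(ℝ, ℝ) 1 V)
    (hφ : ContMDiff (𝓡 n) (𝓡 m) 2 φ) (x w : E n) :
    fderiv ℝ (energyDensity (m := m) V φ) x w =
      1 / 2 * ∑ i, fderiv ℝ (fun z ↦ pullbackMetric (𝓡 m) φ z (stdVec i) (stdVec i)) x w -
        inner ℝ (grad V (φ x)) (mfderiv (𝓡 n) (𝓡 m) φ x w) := by
  have hVx := (hV.mdifferentiable one_ne_zero) (φ x)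
  have hφx := (hφ.mdifferentiable two_ne_zero) x
  have hdiag (i : Fin n) :
      DifferentiableAt ℝ (fun z ↦ pullbackMetric (𝓡 m) φ z (stdVec i) (stdVec i)) x :=
    (contDiff_pullbackMetric_apply hφ _ _).differentiable one_ne_zero x
  have hVφ : DifferentiableAt ℝ (fun z ↦ V (φ z)) x := (hVx.comp x hφx).differentiableAt
  rw [funext (energyDensity_eq_pullbackMetric V φ), inner_grad_mfderiv hVx hφx,
    fderiv_fun_sub ((DifferentiableAt.fun_sum fun i _ ↦ hdiag i).const_mul _) hVφ,
    fderiv_const_mul (DifferentiableAt.fun_sum fun i _ ↦ hdiag i),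
    fderiv_fun_sum fun i _ ↦ hdiag i]
  simp only [sub_apply, smul_apply, sum_apply, smul_eq_mul]

theorem divergence_stressTensor (hV : ContMDiff (𝓡 m) 𝓘(ℝ, ℝ) 1 V)
    (hφ : ContMDiff (𝓡 n) (𝓡 m) 2 φ) (x w : E n) :
    divergence (fun z ↦ stressTensor (m := m) V φ z w) x =
      -inner ℝ (tension (m := m) φ x + grad V (φ x)) (mfderiv (𝓡 n) (𝓡 m) φ x w) := by
  have he := (contDiff_energyDensity hV hφ).differentiable one_ne_zero x
  have hh (i : Fin n) : DifferentiableAt ℝ (fun z ↦ pullbackMetric (𝓡 m) φ z (stdVec i) w) x :=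
    (contDiff_pullbackMetric_apply hφ _ _).differentiable one_ne_zero x
  have hS : DifferentiableAt ℝ (fun z ↦ stressTensor (m := m) V φ z w) x :=
    ((contDiff_stressTensor hV hφ).clm_apply contDiff_const).differentiable one_ne_zero x
  have hcomponent (i : Fin n) :
      fderiv ℝ (fun z ↦ stressTensor (m := m) V φ z w i) x (stdVec i) =
        w i * fderiv ℝ (energyDensity (m := m) V φ) x (stdVec i) -
          fderiv ℝ (fun z ↦ pullbackMetric (𝓡 m) φ z (stdVec i) w) x (stdVec i) := by
    simp only [stressTensor_apply_apply]
    rw [fderiv_fun_sub (he.mul_const _) (hh i), fderiv_mul_const he]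
    rfl
  have hgradient := clm_apply_eq_sum_stdVec (fderiv ℝ (energyDensity (m := m) V φ) x) w
  simp only [divergence_eq_sum_fderiv_repr (EuclideanSpace.basisFun (Fin n) ℝ).toBasis hS,
    OrthonormalBasis.coe_toBasis_repr_apply, OrthonormalBasis.coe_toBasis,
    EuclideanSpace.basisFun_repr, coe_basisFun, hcomponent, Finset.sum_sub_distrib]
  rw [inner_add_left (E := TangentSpace (𝓡 m) (φ x)), inner_tension_mfderiv hφ]
  simp only [Finset.sum_sub_distrib, ← Finset.mul_sum]
  simp only [smul_eq_mul] at hgradient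
  rw [← hgradient, fderiv_energyDensity hV hφ]
  ring

end StressTensor

section SurfaceMeasure

variable {n : ℕ} {F : Type*} [NormedAddCommGroup F] {r : ℝ}

theorem measurableEmbedding_add_smul_sphere (x : E n) (hr : r ≠ 0) :
    MeasurableEmbedding fun s : sphere (0 : E n) 1 ↦ x + r • (s : E n) := by
  have hinj : Function.Injective fun s : sphere (0 : E n) 1 ↦ x + r • (s : E n) := fun s t h ↦
    Subtype.ext (smul_right_injective (E n) hr (add_left_cancel h))
  exact (Continuous.isClosedEmbedding (by fun_prop) hinj).measurableEmbedding

theorem integral_surfaceMeasure [NormedSpace ℝ F] (f : E n → F) (x : E n) (hr : 0 < r) :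
    ∫ y, f y ∂surfaceMeasure x r = sphereIntegral volume f x r := by
  rw [surfaceMeasure, integral_smul_measure,
    (measurableEmbedding_add_smul_sphere x hr.ne').integral_map,
    ENNReal.toReal_ofReal (pow_nonneg hr.le _), sphereIntegral, finrank_euclideanSpace_fin]

theorem integrable_surfaceMeasure {f : E n → F} {x : E n} (hf : ContinuousOn f (sphere x r))
    (hr : 0 < r) : Integrable f (surfaceMeasure x r) :=
  (((measurableEmbedding_add_smul_sphere x hr.ne').integrable_map_iff).2
    (integrable_comp_add_smul_sphere hf hr.le)).smul_measure ENNReal.ofReal_ne_top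

end SurfaceMeasure

section Monotonicity

variable {n m : ℕ} {N : Type*} [TopologicalSpace N] [ChartedSpace (E m) N]
  [Bundle.RiemannianBundle (fun q : N ↦ TangentSpace (𝓡 m) q)] [IsManifold (𝓡 m) 2 N]
  [IsContMDiffRiemannianBundle (𝓡 m) 1 (E m) (fun q : N ↦ TangentSpace (𝓡 m) q)]
  {V : N → ℝ} {φ : E n → N} {r : ℝ}

theorem continuousOn_norm_radialDeriv_sq (hφ : ContMDiff (𝓡 n) (𝓡 m) 2 φ) (x : E n)
    (hr : 0 < r) : ContinuousOn (fun y ↦ ‖radialDeriv (m := m) φ x y‖ ^ 2) (sphere x r) := by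
  have hunit : ContinuousOn (fun y ↦ ‖y - x‖⁻¹ • (y - x)) (sphere x r) :=
    ContinuousOn.smul (ContinuousOn.inv₀ (by fun_prop) fun y hy ↦
      (mem_sphere_iff_norm.1 hy).trans_ne hr.ne') (by fun_prop)
  exact (((contDiff_pullbackMetric hφ).continuous.continuousOn.clm_apply hunit).clm_apply
    hunit).congr fun y _ ↦ (pullbackMetric_self φ y _).symm

theorem pohozaev_identity (hV : ContMDiff (𝓡 m) 𝓘(ℝ, ℝ) 1 V)
    (hφ : ContMDiff (𝓡 n) (𝓡 m) 2 φ) (hτ : ∀ y, tension (m := m) φ y = -grad V (φ y))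
    (x : E n) (hr : 0 < r) :
    (n - 2) * (∫ y in ball x r, energyDensity (m := m) V φ y) - 2 * ∫ y in ball x r, V (φ y) =
      r * (sphereIntegral volume (energyDensity (m := m) V φ) x r -
        sphereIntegral volume (fun y ↦ ‖radialDeriv (m := m) φ x y‖ ^ 2) x r) := by
  have he := (contDiff_energyDensity hV hφ).continuous
  have hVφ : Continuous fun y ↦ V (φ y) := hV.continuous.comp hφ.continuous
  have hdiv (w y : E n) : divergence (fun z ↦ stressTensor (m := m) V φ z w) y = 0 := by
    rw [divergence_stressTensor hV hφ, hτ, neg_add_cancel, inner_zero_left, neg_zero]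
  have hflux := setIntegral_ball_trace_of_divergence_eq_zero (μ := volume)
    (contDiff_stressTensor hV hφ) hdiv x hr
  have hnormal : EqOn (fun y ↦ ⟪stressTensor (m := m) V φ y (‖y - x‖⁻¹ • (y - x)),
      ‖y - x‖⁻¹ • (y - x)⟫) (fun y ↦ energyDensity (m := m) V φ y -
        ‖radialDeriv (m := m) φ x y‖ ^ 2) (sphere x r) := fun y hy ↦ by
    have hunit : ‖‖y - x‖⁻¹ • (y - x)‖ = 1 :=
      norm_smul_inv_norm (𝕜 := ℝ) (norm_ne_zero_iff.1 ((mem_sphere_iff_norm.1 hy).trans_ne hr.ne'))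
    simp only [inner_stressTensor, hunit, one_pow, mul_one]
    rfl
  rw [sphereIntegral_congr hr.le hnormal, sphereIntegral_sub he.continuousOn
    (continuousOn_norm_radialDeriv_sq hφ x hr) hr.le] at hflux
  rw [← hflux]
  simp only [trace_stressTensor]
  rw [integral_sub ((integrableOn_ball he x r).const_mul _)
    ((integrableOn_ball hVφ x r).const_mul _), integral_const_mul, integral_const_mul]

end Monotonicity

end HarmonicPotential

end

open HarmonicPotential MeasureTheory Metric in
theorem mainTheorem6_general {n m : ℕ} {N : Type*} [TopologicalSpace N]
    [ChartedSpace (EuclideanSpace ℝ (Fin m)) N] [IsManifold (𝓡 m) 2 N]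
    [Bundle.RiemannianBundle (fun q : N ↦ TangentSpace (𝓡 m) q)]
    [IsContMDiffRiemannianBundle (𝓡 m) 1 (EuclideanSpace ℝ (Fin m))
      (fun q : N ↦ TangentSpace (𝓡 m) q)]
    (V : N → ℝ) (hV : ContMDiff (𝓡 m) 𝓘(ℝ, ℝ) 1 V)
    (φ : EuclideanSpace ℝ (Fin n) → N) (hφ : ContMDiff (𝓡 n) (𝓡 m) 2 φ)
    (hτ : ∀ y, tension (m := m) φ y = -grad V (φ y))
    (x : EuclideanSpace ℝ (Fin n)) (r : ℝ) (hr : 0 < r) :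
    IntegrableOn (energyDensity (m := m) V φ) (ball x r) ∧
    IntegrableOn (fun y ↦ V (φ y)) (ball x r) ∧
    Integrable (fun y ↦ ‖radialDeriv (m := m) φ x y‖ ^ 2) (surfaceMeasure x r) ∧
    HasDerivAt
      (fun ρ : ℝ ↦ ρ ^ (2 - (n : ℤ)) * ∫ y in ball x ρ, energyDensity (m := m) V φ y)
      (r ^ (2 - (n : ℤ)) * (∫ y, ‖radialDeriv (m := m) φ x y‖ ^ 2 ∂surfaceMeasure x r) -
        2 * r ^ (1 - (n : ℤ)) * ∫ y in ball x r, V (φ y))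
      r := by
  have he := (contDiff_energyDensity hV hφ).continuous
  refine ⟨integrableOn_ball he x r, integrableOn_ball (hV.continuous.comp hφ.continuous) x r,
    integrable_surfaceMeasure (continuousOn_norm_radialDeriv_sq hφ x hr) hr, ?_⟩
  rw [integral_surfaceMeasure _ x hr]
  have hpohozaev := pohozaev_identity hV hφ hτ x hr
  have hpow₁ : r ^ (2 - (n : ℤ)) = r ^ (1 - (n : ℤ)) * r := by
    rw [← zpow_add_one₀ hr.ne', sub_add_eq_add_sub, one_add_one_eq_two]
  have hpow₂ : 2 - (n : ℤ) - 1 = 1 - (n : ℤ) := by ring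
  refine ((hasDerivAt_zpow (2 - (n : ℤ)) r (Or.inl hr.ne')).mul
    (hasDerivAt_setIntegral_ball he x hr)).congr_deriv ?_
  rw [hpow₂, hpow₁]
  push_cast
  linear_combination -r ^ (1 - (n : ℤ)) * hpohozaev

theorem mainTheorem6 {n m : ℕ} {N : Type*} [TopologicalSpace N]
    [ChartedSpace (EuclideanSpace ℝ (Fin m)) N] [IsManifold (𝓡 m) ∞ N]
    [Bundle.RiemannianBundle (fun q : N ↦ TangentSpace (𝓡 m) q)]
    [IsContMDiffRiemannianBundle (𝓡 m) ∞ (EuclideanSpace ℝ (Fin m))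
      (fun q : N ↦ TangentSpace (𝓡 m) q)]
    (V : N → ℝ) (hV : ContMDiff (𝓡 m) 𝓘(ℝ, ℝ) ∞ V)
    (φ : EuclideanSpace ℝ (Fin n) → N)
    (hφ : HarmonicPotential.IsHarmonicMapWithPotential (m := m) V φ)
    (x : EuclideanSpace ℝ (Fin n)) (r : ℝ) (hr : 0 < r) :
    MeasureTheory.IntegrableOn (HarmonicPotential.energyDensity (m := m) V φ) (Metric.ball x r) ∧
    MeasureTheory.IntegrableOn (fun y ↦ V (φ y)) (Metric.ball x r) ∧
    MeasureTheory.Integrable (fun y ↦ ‖HarmonicPotential.radialDeriv (m := m) φ x y‖ ^ 2)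
      (HarmonicPotential.surfaceMeasure x r) ∧
    HasDerivAt
      (fun ρ : ℝ ↦ ρ ^ (2 - (n : ℤ)) *
        ∫ y in Metric.ball x ρ, HarmonicPotential.energyDensity (m := m) V φ y)
      (r ^ (2 - (n : ℤ)) *
          (∫ y, ‖HarmonicPotential.radialDeriv (m := m) φ x y‖ ^ 2
            ∂(HarmonicPotential.surfaceMeasure x r)) -
        2 * r ^ (1 - (n : ℤ)) * ∫ y in Metric.ball x r, V (φ y))
      r := by
  have := IsContMDiffRiemannianBundle.of_le (IB := 𝓡 m) (n := ∞) (n' := 1)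
    (F := EuclideanSpace ℝ (Fin m)) (E := fun q : N ↦ TangentSpace (𝓡 m) q) ENat.LEInfty.out
  exact mainTheorem6_general V (hV.of_le ENat.LEInfty.out) φ (hφ.smooth.of_le ENat.LEInfty.out)
    hφ.equation x r hr
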